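/- For a real matrix $A$ let $\lambda_1(A)\ge\lambda_2(A)\ge\cdots\ge 0$ be its singular values (extended by zeros), $\|A\|$ its operator norm and $\|A\|_\infty=\max_{i,j}|A_{ij}|$. For possibly random real sequences, $X_N=O_P(Y_N)$ means that for every $\varepsilon>0$ there is a constant $C$ with $P(|X_N|>C|Y_N|)\le\varepsilon$ for all large $N$, and $X_N=o_P(Y_N)$ means that $P(|X_N|>\delta|Y_N|)\to0$ for every $\delta>0$. For each $N$ let $\Sigma=L+S$ be (possibly random) real $N\times N_1$ matrices, where $N_1$ may depend on $N$ and $r=\mathrm{rank}(L)$ is non-random, may depend on $N$, and is bounded. Put $g_N=\max_{2\le i\le r+1}|\lambda_{i-1}(L)-\lambda_i(L)|$ and suppose that $\min_{2\le i\le r+1}|\lambda_{i-1}(L)-\lambda_i(L)|\asymp g_N$ (that is, $g_N$ is $O_P$ of this minimum). Let $\widehat\Sigma$ be a random $N\times N_1$ matrix and $\eta_N,c_N\ge 0$ with $$\|\widehat\Sigma-\Sigma\|=O_P(\eta_N),\qquad \|\widehat\Sigma-\Sigma\|_\infty=O_P(c_N),\qquad \eta_N+\|S\|=o_P(g_N).$$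 Fix singular value decompositions of $L$ and of $\widehat\Sigma$. Let $\xi$ ($N\times r$) and $\zeta$ ($N_1\times r$) be the matrices of the leading $r$ left and right singular vectors $\xi_d,\zeta_d$ of $L$, let $\widehat\xi$ be the matrix of the leading $r$ left singular vectors of $\widehat\Sigma$, with signs such that $\widehat\xi_d'\xi_d\ge0$ for all $d\le r$, and let $\widehat L$ be obtained from the singular value decomposition of $\widehat\Sigma$ by keeping the $r$ largest singular values and replacing the others by zero. Then: (i) $$\|\widehat L-L\|=O_P(\eta_N+\|S\|),\qquad \|\widehat\xi-\xi\|=O_P\Big(\frac{\eta_N+\|S\|}{g_N}\Big).$$ (ii) If in addition $\|S\|_\infty+\|L\|_\infty=O_P(1)$ and $N_1c_N=o_P(g_N)$, then $$\|\widehat\xi-\xi\|_\infty=O_P\Big(\Big(\frac{N_1}{\sqrt N}+\sqrt{N_1}\Big)\frac{\eta_N+\|S\|}{g_N^{2}}+\Big(c_N\frac{N_1}{\sqrt N}+c_N\sqrt{N_1}+\max_{d\le r}\big(\|S\zeta_d\|_\infty\vee\|S'\xi_d\|_\infty\big)\Big)\frac1{g_N}\Big),$$ and the same bound holds column by column, uniformly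 in $d\le r$: with $\|\widehat\xi_d-\xi_d\|_\infty$ on the left and $\|S\zeta_d\|_\infty\vee\|S'\xi_d\|_\infty$, without the maximum over $d$, on the right. -/

import Mathlib

open MeasureTheory Filter Topology
open scoped Matrix Matrix.Norms.L2Operator

/-
Throughout, `‖A‖` for a real matrix `A` is the (rectangular) `ℓ²` operator norm
`√(λ_max(Aᵀ A))`.  A vector `v : Fin m → ℝ` carries the sup norm `‖v‖ = max_i |v i|`.
-/

namespace SpikedLowRank

/-- The element-wise norm `‖A‖_∞ = max_{i,j} |A i j|` (and `0` for an empty matrix). -/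
noncomputable def entryNorm {m n : ℕ} (A : Matrix (Fin m) (Fin n) ℝ) : ℝ :=
  ⨆ i, ⨆ j, |A i j|

/-- The singular values of `A` in decreasing order with multiplicity, extended by zero.
Indices start at `0`: `singVal A i` is the `(i+1)`-th largest singular value. -/
noncomputable def singVal {m n : ℕ} (A : Matrix (Fin m) (Fin n) ℝ) (i : ℕ) : ℝ :=
  (Matrix.toEuclideanLin A).singularValues i

/-- `A = U D Vᵀ` is a (thin) singular value decomposition: `U` and `V` have orthonormal columns
and `D` is the diagonal matrix of the decreasingly ordered singular values of `A`. -/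
structure IsSVD {m n : ℕ} (A : Matrix (Fin m) (Fin n) ℝ)
    (U : Matrix (Fin m) (Fin (min m n)) ℝ) (V : Matrix (Fin n) (Fin (min m n)) ℝ) : Prop where
  left_orthonormal : Uᵀ * U = 1
  right_orthonormal : Vᵀ * V = 1
  eq_mul : A = U * Matrix.diagonal (fun i : Fin (min m n) => singVal A i) * Vᵀ

/-- The singular value hard thresholding `H_R(A) = U D_R Vᵀ`, where `(U, V)` is the SVD of `A`
that is used and `D_R` keeps the top `R` singular values and replaces the others by zero. -/
noncomputable def hardThreshold {m n : ℕ} (R : ℕ) (A : Matrix (Fin m) (Fin n) ℝ)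
    (U : Matrix (Fin m) (Fin (min m n)) ℝ) (V : Matrix (Fin n) (Fin (min m n)) ℝ) :
    Matrix (Fin m) (Fin n) ℝ :=
  U * Matrix.diagonal (fun i : Fin (min m n) => if (i : ℕ) < R then singVal A i else 0) * Vᵀ

/-- The matrix of the first `r` columns. -/
def leadingCols {m k r : ℕ} (h : r ≤ k) (U : Matrix (Fin m) (Fin k) ℝ) :
    Matrix (Fin m) (Fin r) ℝ :=
  U.submatrix id (Fin.castLE h)

/-- `max_{2 ≤ i ≤ r+1} |λ_{i-1}(A) - λ_i(A)|`. -/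
noncomputable def maxGap {m n : ℕ} (r : ℕ) (A : Matrix (Fin m) (Fin n) ℝ) : ℝ :=
  ⨆ i : Fin r, |singVal A i - singVal A (i + 1)|

/-- `min_{2 ≤ i ≤ r+1} |λ_{i-1}(A) - λ_i(A)|`. -/
noncomputable def minGap {m n : ℕ} (r : ℕ) (A : Matrix (Fin m) (Fin n) ℝ) : ℝ :=
  ⨅ i : Fin r, |singVal A i - singVal A (i + 1)|

/-- `X_N = O_P(Y_N)`: for every `ε > 0` there is a constant `C` such that
`P(|X_N| > C |Y_N|) ≤ ε` for all large `N`. -/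
def IsBigOP {Ω : Type*} [MeasurableSpace Ω] (P : Measure Ω) (X Y : ℕ → Ω → ℝ) : Prop :=
  ∀ ε : ℝ, 0 < ε → ∃ C : ℝ, 0 < C ∧
    ∀ᶠ N in atTop, P {ω | C * |Y N ω| < |X N ω|} ≤ ENNReal.ofReal ε

/-- `X_{N,d} = O_P(Y_{N,d})` uniformly in `d < r_N`. -/
def IsBigOPUnif {Ω : Type*} [MeasurableSpace Ω] (P : Measure Ω) {r : ℕ → ℕ}
    (X Y : ∀ N, Fin (r N) → Ω → ℝ) : Prop :=
  ∀ ε : ℝ, 0 < ε → ∃ C : ℝ, 0 < C ∧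
    ∀ᶠ N in atTop, P {ω | ∃ d, C * |Y N d ω| < |X N d ω|} ≤ ENNReal.ofReal ε

/-- `X_N = o_P(Y_N)`: for every `δ > 0`, `P(|X_N| > δ |Y_N|) → 0`. -/
def IsLittleOP {Ω : Type*} [MeasurableSpace Ω] (P : Measure Ω) (X Y : ℕ → Ω → ℝ) : Prop :=
  ∀ δ : ℝ, 0 < δ → Tendsto (fun N => P {ω | δ * |Y N ω| < |X N ω|}) atTop (𝓝 0)

end SpikedLowRank

namespace SpikedLowRank
open scoped RealInnerProductSpace

/-! ### Perturbation of singular pairs and singular values in inner product spaces. -/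

section SingularSubspaces

variable {E F : Type*} [NormedAddCommGroup E] [InnerProductSpace ℝ E]
  [NormedAddCommGroup F] [InnerProductSpace ℝ F]

/-! The argument is deterministic on an event of probability close to one (`PerturbationRegime`);
there the estimator `A` satisfies `‖A - L‖ ≤ e` with `e = C (η + ‖S‖)` small relative to the gaps.
Weyl's inequality `singularValue_le_add_norm_sub` puts the singular values of `A` within `e` of
those of `L`, which already controls hard thresholding.

For a leading pair `(x, y)` of `A` with value `s`, write `s x = L y + p` and `s y = Lᵀ x + q`, with
`p`, `q` of norm at most `e`. Pairing these with `u i`, `v i`, then adding and subtracting,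
decouples the coefficients: the factors are `s - σ i` and `s + σ i`, both of the order of the gap at
least for `i ≠ d`. Hence `x` is within `O(e / gap)` of the line of `u d`, and the sign convention
turns this into closeness to `u d` (`singularPair_norm_sub_le`).

The sup-norm bound expands `s (x - u d)` entrywise. Since `σ i u i = L v i`, Cauchy-Schwarz on the
rows of `L` bounds these entries by `√N₁ ‖L‖_∞`, without assuming that the singular vectors are
delocalized; dividing by `s`, of the order of the gap at least, gives the rate
(`IsSVD.norm_col_sub_le`). -/

theorem inner_sum_smul_add {r : ℕ} {u : Fin r → F} (hu : Orthonormal ℝ u) {s : ℝ} {x p : F}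
    {c : Fin r → ℝ} (h : s • x = ∑ i, c i • u i + p) (i : Fin r) :
    s * ⟪u i, x⟫ = c i + ⟪u i, p⟫ := by
  have := congrArg (fun z => ⟪u i, z⟫) h
  simpa [inner_smul_right, inner_add_right, hu.inner_right_fintype c i] using this

theorem abs_inner_le_of_orthonormal {r : ℕ} {u : Fin r → F} (hu : Orthonormal ℝ u) (i : Fin r)
    (p : F) : |⟪u i, p⟫| ≤ ‖p‖ := by
  simpa [hu.1 i] using abs_real_inner_le_norm (u i) p

theorem norm_sum_smul_le {r : ℕ} {u : Fin r → F} (hu : Orthonormal ℝ u) (t : Finset (Fin r))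
    {c : Fin r → ℝ} {b : ℝ} (hb : 0 ≤ b) (hc : ∀ i ∈ t, |c i| ≤ b) :
    ‖∑ i ∈ t, c i • u i‖ ≤ r * b := by
  calc ‖∑ i ∈ t, c i • u i‖ ≤ ∑ i ∈ t, b := by
        refine (norm_sum_le _ _).trans (Finset.sum_le_sum fun i hi => ?_)
        simpa [norm_smul, hu.1 i] using hc i hi
    _ = t.card * b := by simp
    _ ≤ r * b := by
        gcongr
        simpa using t.card_le_univ

/-- Perturbation of a singular pair `(x, y)` whose singular value `s` is close to `σ d` and whose
singular equations hold up to the errors `p` and `q`. -/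
theorem singularPair_perturbation {r : ℕ} {u : Fin r → F} (hu : Orthonormal ℝ u)
    {v : Fin r → E} (hv : Orthonormal ℝ v) {σ : Fin r → ℝ} {d : Fin r} {x p : F} {y q : E}
    {s e m : ℝ} (hm : 0 < m) (hgap : ∀ i, i ≠ d → m ≤ |σ d - σ i|) (hσ : ∀ i, m ≤ σ i)
    (hs : |s - σ d| ≤ e) (hem : 2 * e ≤ m)
    (hx : s • x = ∑ i, (σ i * ⟪v i, y⟫) • u i + p)
    (hy : s • y = ∑ i, (σ i * ⟪u i, x⟫) • v i + q)
    (hp : ‖p‖ ≤ e) (hq : ‖q‖ ≤ e) :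
    (∀ i, i ≠ d → |⟪u i, x⟫| ≤ 4 * (e / m)) ∧
      ‖x - ⟪u d, x⟫ • u d‖ ≤ (6 * r + 2) * (e / m) ∧
      |⟪u d, x⟫ - ⟪v d, y⟫| ≤ 2 * (e / m) := by
  have he : 0 ≤ e := (abs_nonneg _).trans hs
  have hsm : m / 2 ≤ s := by have := hσ d; rw [abs_le] at hs; linarith
  have hs0 : 0 < s := by linarith
  have hem0 : 0 ≤ e / m := by positivity
  have key1 : ∀ i, s * ⟪u i, x⟫ = σ i * ⟪v i, y⟫ + ⟪u i, p⟫ := inner_sum_smul_add hu hx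
  have key2 : ∀ i, s * ⟪v i, y⟫ = σ i * ⟪u i, x⟫ + ⟪v i, q⟫ := inner_sum_smul_add hv hy
  have hpi : ∀ i, |⟪u i, p⟫| ≤ e := fun i => (abs_inner_le_of_orthonormal hu i p).trans hp
  have hqi : ∀ i, |⟪v i, q⟫| ≤ e := fun i => (abs_inner_le_of_orthonormal hv i q).trans hq
  -- Subtracting the two projected equations leaves the factor `s + σ i ≥ m`; adding them, in
  -- `hoff`, leaves `s - σ i`, which is at least `m / 2` in absolute value for `i ≠ d`.
  have hdiff : ∀ i, |⟪u i, x⟫ - ⟪v i, y⟫| ≤ 2 * (e / m) := by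
    intro i
    have h1 : (s + σ i) * (⟪u i, x⟫ - ⟪v i, y⟫) = ⟪u i, p⟫ - ⟪v i, q⟫ := by
      linarith [key1 i, key2 i]
    have h2 : m * |⟪u i, x⟫ - ⟪v i, y⟫| ≤ 2 * e := by
      calc m * |⟪u i, x⟫ - ⟪v i, y⟫| ≤ |s + σ i| * |⟪u i, x⟫ - ⟪v i, y⟫| := by
            gcongr
            exact le_trans (by linarith [hσ i]) (le_abs_self _)
        _ = |⟪u i, p⟫ - ⟪v i, q⟫| := by rw [← abs_mul, h1]
        _ ≤ 2 * e := by linarith [abs_sub (⟪u i, p⟫) (⟪v i, q⟫), hpi i, hqi i]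
    rw [← mul_div_assoc, le_div_iff₀ hm]; linarith
  have hoff : ∀ i, i ≠ d → |⟪u i, x⟫| ≤ 4 * (e / m) := by
    intro i hi
    have h1 : (s - σ i) * (⟪u i, x⟫ + ⟪v i, y⟫) = ⟪u i, p⟫ + ⟪v i, q⟫ := by
      linarith [key1 i, key2 i]
    have hsi : m / 2 ≤ |s - σ i| := by
      have := abs_sub_le (σ d) s (σ i)
      rw [abs_sub_comm (σ d) s] at this
      linarith [hgap i hi]
    have h2 : m / 2 * |⟪u i, x⟫ + ⟪v i, y⟫| ≤ 2 * e := by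
      calc m / 2 * |⟪u i, x⟫ + ⟪v i, y⟫| ≤ |s - σ i| * |⟪u i, x⟫ + ⟪v i, y⟫| := by gcongr
        _ = |⟪u i, p⟫ + ⟪v i, q⟫| := by rw [← abs_mul, h1]
        _ ≤ 2 * e := by linarith [abs_add_le (⟪u i, p⟫) (⟪v i, q⟫), hpi i, hqi i]
    have h3 : |⟪u i, x⟫ + ⟪v i, y⟫| ≤ 4 * (e / m) := by
      rw [← mul_div_assoc, le_div_iff₀ hm]; linarith
    have h4 := hdiff i
    rw [abs_le] at h3 h4 ⊢
    constructor <;> linarith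
  refine ⟨hoff, ?_, hdiff d⟩
  -- Outside the span of the `u i` only the error `p` contributes.
  have hw : s • (x - ∑ i, ⟪u i, x⟫ • u i) = p - ∑ i, ⟪u i, p⟫ • u i := by
    rw [smul_sub, hx, Finset.smul_sum]
    simp_rw [smul_smul, key1, add_smul, Finset.sum_add_distrib]
    abel
  have hwn : ‖x - ∑ i, ⟪u i, x⟫ • u i‖ ≤ (2 * r + 2) * (e / m) := by
    have h1 : s * ‖x - ∑ i, ⟪u i, x⟫ • u i‖ ≤ e + r * e := by
      calc s * ‖x - ∑ i, ⟪u i, x⟫ • u i‖ = ‖p - ∑ i, ⟪u i, p⟫ • u i‖ := by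
            rw [← hw, norm_smul, Real.norm_of_nonneg hs0.le]
        _ ≤ e + r * e := (norm_sub_le _ _).trans
            (add_le_add hp (norm_sum_smul_le hu _ he fun i _ => hpi i))
    have h2 : m / 2 * ‖x - ∑ i, ⟪u i, x⟫ • u i‖ ≤ s * ‖x - ∑ i, ⟪u i, x⟫ • u i‖ := by gcongr
    rw [← mul_div_assoc, le_div_iff₀ hm]; linarith
  -- The constant `6 r + 2` is `2 r + 2` from outside the span plus `4` for each remaining
  -- direction.
  have hsplit : x - ⟪u d, x⟫ • u d =
      (x - ∑ i, ⟪u i, x⟫ • u i) + ∑ i ∈ Finset.univ.erase d, ⟪u i, x⟫ • u i := by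
    rw [← Finset.add_sum_erase _ _ (Finset.mem_univ d)]
    abel
  rw [hsplit]
  refine (norm_add_le _ _).trans ?_
  have := norm_sum_smul_le hu (Finset.univ.erase d) (c := fun i => ⟪u i, x⟫)
    (b := 4 * (e / m)) (by positivity) (fun i hi => hoff i (Finset.ne_of_mem_erase hi))
  linarith

/-- With `t = ⟪z, x⟫ ∈ [0, 1]`, the triangle inequality gives `1 ≤ t + ‖x - t z‖`, so moving from `t
z` to `z` costs no more than the distance from `x` to `t z`. -/
theorem norm_sub_le_of_inner_nonneg {x z : F} (hx : ‖x‖ = 1) (hz : ‖z‖ = 1) (h : 0 ≤ ⟪z, x⟫) :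
    ‖x - z‖ ≤ 2 * ‖x - ⟪z, x⟫ • z‖ := by
  have h1 : ⟪z, x⟫ ≤ 1 := by simpa [hx, hz] using real_inner_le_norm z x
  have h2 : 1 ≤ ⟪z, x⟫ + ‖x - ⟪z, x⟫ • z‖ := by
    have := norm_add_le (x - ⟪z, x⟫ • z) (⟪z, x⟫ • z)
    rw [sub_add_cancel, hx, norm_smul, hz, Real.norm_of_nonneg h] at this
    linarith
  have h3 : x - z = (x - ⟪z, x⟫ • z) + (⟪z, x⟫ - 1) • z := by
    rw [sub_smul, one_smul]; abel
  have h4 : ‖(⟪z, x⟫ - 1) • z‖ = 1 - ⟪z, x⟫ := by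
    rw [norm_smul, hz, Real.norm_of_nonpos (by linarith)]; ring
  calc ‖x - z‖ ≤ ‖x - ⟪z, x⟫ • z‖ + ‖(⟪z, x⟫ - 1) • z‖ := by
        conv_lhs => rw [h3]
        exact norm_add_le _ _
    _ ≤ 2 * ‖x - ⟪z, x⟫ • z‖ := by rw [h4]; linarith

/-- Only the left sign is prescribed. The smallness constant `6 r + 4` transfers it to the right:
`⟪u d, x⟫ ≥ 1 - (6 r + 2) e / m`, and `⟪v d, y⟫` differs from it by at most `2 e / m`. -/
theorem singularPair_norm_sub_le {r : ℕ} {u : Fin r → F} (hu : Orthonormal ℝ u)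
    {v : Fin r → E} (hv : Orthonormal ℝ v) {σ : Fin r → ℝ} {d : Fin r} {x p : F} {y q : E}
    {s e m : ℝ} (hm : 0 < m) (hgap : ∀ i, i ≠ d → m ≤ |σ d - σ i|) (hσ : ∀ i, m ≤ σ i)
    (hs : |s - σ d| ≤ e) (hem : (6 * r + 4) * e ≤ m)
    (hx : s • x = ∑ i, (σ i * ⟪v i, y⟫) • u i + p)
    (hy : s • y = ∑ i, (σ i * ⟪u i, x⟫) • v i + q)
    (hp : ‖p‖ ≤ e) (hq : ‖q‖ ≤ e) (hx1 : ‖x‖ = 1) (hy1 : ‖y‖ = 1) (hsign : 0 ≤ ⟪u d, x⟫) :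
    (∀ i, i ≠ d → |⟪v i, y⟫| ≤ 4 * (e / m)) ∧
      ‖x - u d‖ ≤ (12 * r + 4) * (e / m) ∧ ‖y - v d‖ ≤ (12 * r + 4) * (e / m) := by
  have he : 0 ≤ e := (abs_nonneg _).trans hs
  have hr0 : (0 : ℝ) ≤ r * e := by positivity
  have hem2 : 2 * e ≤ m := by nlinarith
  obtain ⟨-, hxd, hdiff⟩ := singularPair_perturbation hu hv hm hgap hσ hs hem2 hx hy hp hq
  obtain ⟨hyo, hyd, -⟩ := singularPair_perturbation hv hu hm hgap hσ hs hem2 hy hx hq hp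
  refine ⟨hyo, ?_, ?_⟩
  · linarith [norm_sub_le_of_inner_nonneg hx1 (hu.1 d) hsign]
  · have h1 : 1 ≤ ⟪u d, x⟫ + ‖x - ⟪u d, x⟫ • u d‖ := by
      have := norm_add_le (x - ⟪u d, x⟫ • u d) (⟪u d, x⟫ • u d)
      rw [sub_add_cancel, hx1, norm_smul, hu.1 d, Real.norm_of_nonneg hsign] at this
      linarith
    have h2 : (6 * r + 4) * (e / m) ≤ 1 := by
      rw [← mul_div_assoc, div_le_one hm]; exact hem
    have h3 : 0 ≤ ⟪v d, y⟫ := by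
      rw [abs_le] at hdiff
      linarith
    linarith [norm_sub_le_of_inner_nonneg hy1 (hv.1 d) h3]

/-- One half of Weyl's perturbation inequality for singular values. -/
theorem singularValue_le_add_norm_sub {k : ℕ} {A B : E →L[ℝ] F} {u u' : Fin k → F}
    {v v' : Fin k → E} (hu : Orthonormal ℝ u) (hv : Orthonormal ℝ v) (hu' : Orthonormal ℝ u')
    (hv' : Orthonormal ℝ v') {σ τ : Fin k → ℝ} (hσ : Antitone σ) (hτ : Antitone τ)
    (hσ0 : ∀ i, 0 ≤ σ i) (hτ0 : ∀ i, 0 ≤ τ i)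
    (hA : ∀ x, A x = ∑ i, (σ i * ⟪v i, x⟫) • u i)
    (hB : ∀ x, B x = ∑ i, (τ i * ⟪v' i, x⟫) • u' i) (d : Fin k) :
    σ d ≤ τ d + ‖A - B‖ := by
  have hd : (d : ℕ) + 1 ≤ k := d.2
  let w : Fin (d + 1) → E := fun i => v (Fin.castLE hd i)
  have hw : Orthonormal ℝ w := hv.comp _ (Fin.castLE_injective hd)
  let T : (Fin (d + 1) → ℝ) →ₗ[ℝ] (Fin d → ℝ) :=
    { toFun := fun c j => ⟪v' (Fin.castLE d.2.le j), ∑ i, c i • w i⟫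
      map_add' := fun a b => by
        ext j; simp [add_smul, Finset.sum_add_distrib, inner_add_right]
      map_smul' := fun t a => by
        ext j; simp [← smul_smul, ← Finset.smul_sum, inner_smul_right] }
  -- Courant-Fischer by dimension count: some nonzero `x` in the `d + 1` dimensional span of the
  -- leading `v i` is orthogonal to the first `d` vectors `v' j`. On it `A` expands by at least `σ
  -- d` and `B` by at most `τ d`.
  obtain ⟨c, hcT, hc0⟩ := (LinearMap.ker T).ne_bot_iff.1
    (LinearMap.ker_ne_bot_of_finrank_lt (f := T) (by simp))
  set x : E := ∑ i, c i • w i with hxdef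
  have hx0 : x ≠ 0 := fun h => hc0 <| by
    have := Fintype.linearIndependent_iff.1 hw.linearIndependent c h
    ext i; exact this i
  have hxn : 0 < ‖x‖ := norm_pos_iff.2 hx0
  have horth : ∀ j : Fin k, j < d → ⟪v' j, x⟫ = 0 := fun j hj =>
    congrFun (LinearMap.mem_ker.1 hcT) ⟨j, hj⟩
  have hin : ∀ j : Fin k, d < j → ⟪v j, x⟫ = 0 := by
    intro j hj
    rw [hxdef, inner_sum]
    refine Finset.sum_eq_zero fun i _ => ?_
    rw [inner_smul_right, hv.2, mul_zero]
    intro h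
    have h1 := i.2
    have h2 : (j : ℕ) = i := congrArg Fin.val h
    have h3 : (d : ℕ) < j := hj
    omega
  have hxsq : ‖x‖ ^ 2 = ∑ i : Fin k, ⟪v i, x⟫ ^ 2 := by
    have h1 : ∑ i : Fin k, ⟪v i, x⟫ ^ 2 = ∑ i : Fin (d + 1), ⟪w i, x⟫ ^ 2 := by
      refine (Finset.sum_of_injOn (Fin.castLE hd) (Fin.castLE_injective hd).injOn (by simp)
        ?_ (fun i _ => rfl)).symm
      intro j _ hj
      rw [hin j, zero_pow two_ne_zero]
      by_contra h
      exact hj ⟨⟨j, Nat.lt_succ_of_le (not_lt.1 h)⟩, by simp, rfl⟩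
    rw [h1, hxdef, ← real_inner_self_eq_norm_sq, hw.inner_sum]
    simp [hw.inner_right_fintype, pow_two]
  have hnorm : ∀ {a : Fin k → F} (_ : Orthonormal ℝ a) (t : Fin k → ℝ),
      ‖∑ i, t i • a i‖ ^ 2 = ∑ i, t i ^ 2 := by
    intro a ha t
    rw [← real_inner_self_eq_norm_sq, ha.inner_sum]
    simp [pow_two]
  have hAx : σ d * ‖x‖ ≤ ‖A x‖ := by
    refine abs_le_of_sq_le_sq' ?_ (norm_nonneg _) |>.2
    rw [hA, hnorm hu, mul_pow, hxsq, Finset.mul_sum]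
    refine Finset.sum_le_sum fun i _ => ?_
    by_cases h : d < i
    · simp [hin i h]
    · rw [mul_pow]
      have := hσ (not_lt.1 h)
      have := hσ0 d
      gcongr
  have hBx : ‖B x‖ ≤ τ d * ‖x‖ := by
    refine abs_le_of_sq_le_sq' ?_ (mul_nonneg (hτ0 d) (norm_nonneg _)) |>.2
    rw [hB, hnorm hu', mul_pow]
    calc ∑ i, (τ i * ⟪v' i, x⟫) ^ 2 ≤ ∑ i, τ d ^ 2 * ⟪v' i, x⟫ ^ 2 := by
          refine Finset.sum_le_sum fun i _ => ?_
          by_cases h : i < d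
          · simp [horth i h]
          · rw [mul_pow]
            have := hτ (not_lt.1 h)
            have := hτ0 i
            gcongr
      _ = τ d ^ 2 * ∑ i, ⟪v' i, x⟫ ^ 2 := by rw [Finset.mul_sum]
      _ ≤ τ d ^ 2 * ‖x‖ ^ 2 := by
          gcongr
          simpa using hv'.sum_inner_products_le (s := Finset.univ) x
  have hABx : ‖A x‖ ≤ ‖B x‖ + ‖A - B‖ * ‖x‖ := by
    have h1 := (A - B).le_opNorm x
    have h2 := norm_add_le (B x) ((A - B) x)
    rw [sub_apply, add_sub_cancel] at h2
    rw [sub_apply] at h1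
    linarith
  refine le_of_mul_le_mul_right ?_ hxn
  linarith

end SingularSubspaces

/-! ### Operator norms, singular value decompositions and entrywise norms of matrices. -/

section MatrixLemmas

variable {m n : ℕ}

theorem ofLp_toEuclideanLin (A : Matrix (Fin m) (Fin n) ℝ) (x : EuclideanSpace ℝ (Fin n)) :
    (Matrix.toEuclideanLin A x).ofLp = A *ᵥ x.ofLp :=
  rfl

/-- The `i`-th column of a matrix as a Euclidean vector. -/
def euclideanCol {k : ℕ} (U : Matrix (Fin m) (Fin k) ℝ) (i : Fin k) :
    EuclideanSpace ℝ (Fin m) :=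
  WithLp.toLp 2 (U.col i)

theorem orthonormal_euclideanCol {k : ℕ} {U : Matrix (Fin m) (Fin k) ℝ} (h : Uᵀ * U = 1) :
    Orthonormal ℝ (euclideanCol U) := by
  rw [orthonormal_iff_ite]
  intro i j
  have := congrFun (congrFun h i) j
  rw [Matrix.one_apply] at this
  rw [← this, euclideanCol, euclideanCol, EuclideanSpace.inner_toLp_toLp, dotProduct_comm]
  rfl

theorem toEuclideanLin_mul_diagonal_mul_transpose {k : ℕ} (U : Matrix (Fin m) (Fin k) ℝ)
    (V : Matrix (Fin n) (Fin k) ℝ) (t : Fin k → ℝ) (x : EuclideanSpace ℝ (Fin n)) :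
    Matrix.toEuclideanLin (U * Matrix.diagonal t * Vᵀ) x =
      ∑ i, (t i * ⟪euclideanCol V i, x⟫) • euclideanCol U i := by
  have hin : ∀ i, ⟪euclideanCol V i, x⟫ = (Vᵀ *ᵥ x.ofLp) i := by
    intro i
    rw [euclideanCol, ← WithLp.toLp_ofLp 2 x, EuclideanSpace.inner_toLp_toLp, dotProduct_comm]
    rfl
  ext j
  rw [ofLp_toEuclideanLin, ← Matrix.mulVec_mulVec, ← Matrix.mulVec_mulVec]
  simp only [WithLp.ofLp_sum, WithLp.ofLp_smul, Finset.sum_apply, Pi.smul_apply, smul_eq_mul, hin]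
  rw [Matrix.mulVec, dotProduct]
  refine Finset.sum_congr rfl fun i _ => ?_
  rw [Matrix.mulVec_diagonal, mul_comm]
  rfl

theorem norm_toEuclideanLin_le (A : Matrix (Fin m) (Fin n) ℝ) (x : EuclideanSpace ℝ (Fin n)) :
    ‖Matrix.toEuclideanLin A x‖ ≤ ‖A‖ * ‖x‖ :=
  A.l2_opNorm_mulVec x

theorem l2_opNorm_transpose (A : Matrix (Fin m) (Fin n) ℝ) : ‖Aᵀ‖ = ‖A‖ := by
  rw [← Matrix.conjTranspose_eq_transpose_of_trivial, Matrix.l2_opNorm_conjTranspose]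

/-- The C⋆-identity gives `‖U‖² = ‖1‖`, which is `0` rather than `1` if there are no columns. -/
theorem l2_opNorm_le_one_of_transpose_mul_self {k : ℕ} {U : Matrix (Fin m) (Fin k) ℝ}
    (h : Uᵀ * U = 1) : ‖U‖ ≤ 1 := by
  have h1 := Matrix.l2_opNorm_conjTranspose_mul_self U
  rw [Matrix.conjTranspose_eq_transpose_of_trivial, h] at h1
  have h2 : ‖(1 : Matrix (Fin k) (Fin k) ℝ)‖ ≤ 1 := by
    rw [← Matrix.diagonal_one, Matrix.l2_opNorm_diagonal]
    exact (pi_norm_le_iff_of_nonneg zero_le_one).2 fun i => by simp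
  nlinarith [norm_nonneg U]

theorem l2_opNorm_mul_diagonal_mul_transpose_le {k : ℕ} {U : Matrix (Fin m) (Fin k) ℝ}
    {V : Matrix (Fin n) (Fin k) ℝ} (hU : Uᵀ * U = 1) (hV : Vᵀ * V = 1) {t : Fin k → ℝ} {b : ℝ}
    (hb : 0 ≤ b) (ht : ∀ i, |t i| ≤ b) : ‖U * Matrix.diagonal t * Vᵀ‖ ≤ b := by
  have hD : ‖(Matrix.diagonal t : Matrix (Fin k) (Fin k) ℝ)‖ ≤ b := by
    rw [Matrix.l2_opNorm_diagonal]
    exact (pi_norm_le_iff_of_nonneg hb).2 ht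
  have h1 := l2_opNorm_le_one_of_transpose_mul_self hU
  have h2 := l2_opNorm_le_one_of_transpose_mul_self hV
  calc ‖U * Matrix.diagonal t * Vᵀ‖ ≤ ‖U * Matrix.diagonal t‖ * ‖Vᵀ‖ := Matrix.l2_opNorm_mul _ _
    _ ≤ (‖U‖ * ‖(Matrix.diagonal t : Matrix (Fin k) (Fin k) ℝ)‖) * ‖V‖ := by
        rw [l2_opNorm_transpose]
        gcongr
        exact Matrix.l2_opNorm_mul _ _
    _ ≤ (1 * b) * 1 := by gcongr
    _ = b := by ring

theorem l2_opNorm_le_sum_euclideanCol {k : ℕ} (M : Matrix (Fin m) (Fin k) ℝ) :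
    ‖M‖ ≤ ∑ i, ‖euclideanCol M i‖ := by
  rw [Matrix.l2_opNorm_def]
  refine ContinuousLinearMap.opNorm_le_bound _ (Finset.sum_nonneg fun _ _ => norm_nonneg _) ?_
  intro x
  have h : Matrix.toEuclideanLin M x = ∑ i, x i • euclideanCol M i := by
    ext j
    rw [ofLp_toEuclideanLin]
    simp only [WithLp.ofLp_sum, WithLp.ofLp_smul, Finset.sum_apply, Pi.smul_apply, smul_eq_mul]
    rw [Matrix.mulVec, dotProduct]
    exact Finset.sum_congr rfl fun i _ => mul_comm _ _
  change ‖Matrix.toEuclideanLin M x‖ ≤ _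
  rw [h, Finset.sum_mul]
  refine (norm_sum_le _ _).trans (Finset.sum_le_sum fun i _ => ?_)
  rw [norm_smul, mul_comm]
  gcongr
  exact PiLp.norm_apply_le x i

theorem singVal_nonneg (A : Matrix (Fin m) (Fin n) ℝ) (i : ℕ) : 0 ≤ singVal A i :=
  LinearMap.singularValues_nonneg _ i

theorem singVal_antitone (A : Matrix (Fin m) (Fin n) ℝ) : Antitone (singVal A) :=
  LinearMap.singularValues_antitone _

theorem singVal_eq_zero_iff (A : Matrix (Fin m) (Fin n) ℝ) (i : ℕ) :
    singVal A i = 0 ↔ A.rank ≤ i := by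
  rw [singVal, LinearMap.singularValues_eq_zero_iff_le_finrank_range,
    Matrix.rank_eq_finrank_range_toLin A (EuclideanSpace.basisFun (Fin m) ℝ).toBasis
      (EuclideanSpace.basisFun (Fin n) ℝ).toBasis, ← Matrix.toEuclideanLin_eq_toLin_orthonormal]

variable {A L : Matrix (Fin m) (Fin n) ℝ} {U U' : Matrix (Fin m) (Fin (min m n)) ℝ}
  {V V' : Matrix (Fin n) (Fin (min m n)) ℝ}

theorem IsSVD.toEuclideanLin_apply (h : IsSVD A U V) (x : EuclideanSpace ℝ (Fin n)) :
    Matrix.toEuclideanLin A x =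
      ∑ i : Fin (min m n), (singVal A i * ⟪euclideanCol V i, x⟫) • euclideanCol U i := by
  conv_lhs => rw [h.eq_mul]
  exact toEuclideanLin_mul_diagonal_mul_transpose _ _ _ _

theorem IsSVD.toEuclideanLin_transpose_apply (h : IsSVD A U V) (y : EuclideanSpace ℝ (Fin m)) :
    Matrix.toEuclideanLin Aᵀ y =
      ∑ i : Fin (min m n), (singVal A i * ⟪euclideanCol U i, y⟫) • euclideanCol V i := by
  conv_lhs => rw [h.eq_mul]
  rw [Matrix.transpose_mul, Matrix.transpose_mul, Matrix.diagonal_transpose,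
    Matrix.transpose_transpose, ← Matrix.mul_assoc]
  exact toEuclideanLin_mul_diagonal_mul_transpose _ _ _ _

theorem IsSVD.toEuclideanLin_col (h : IsSVD A U V) (d : Fin (min m n)) :
    Matrix.toEuclideanLin A (euclideanCol V d) = singVal A d • euclideanCol U d := by
  rw [h.toEuclideanLin_apply, Finset.sum_eq_single d]
  · rw [real_inner_self_eq_norm_sq, (orthonormal_euclideanCol h.right_orthonormal).1]
    simp
  · intro i _ hi
    rw [(orthonormal_euclideanCol h.right_orthonormal).2 hi]
    simp
  · simp

theorem IsSVD.toEuclideanLin_transpose_col (h : IsSVD A U V) (d : Fin (min m n)) :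
    Matrix.toEuclideanLin Aᵀ (euclideanCol U d) = singVal A d • euclideanCol V d := by
  rw [h.toEuclideanLin_transpose_apply, Finset.sum_eq_single d]
  · rw [real_inner_self_eq_norm_sq, (orthonormal_euclideanCol h.left_orthonormal).1]
    simp
  · intro i _ hi
    rw [(orthonormal_euclideanCol h.left_orthonormal).2 hi]
    simp
  · simp

theorem IsSVD.singVal_le_add_norm_sub (hA : IsSVD A U V) (hL : IsSVD L U' V')
    (d : Fin (min m n)) : singVal A d ≤ singVal L d + ‖A - L‖ := by
  have h := singularValue_le_add_norm_sub
    (A := (Matrix.toEuclideanLin (𝕜 := ℝ)).trans LinearMap.toContinuousLinearMap A)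
    (B := (Matrix.toEuclideanLin (𝕜 := ℝ)).trans LinearMap.toContinuousLinearMap L)
    (σ := fun i : Fin (min m n) => singVal A i) (τ := fun i : Fin (min m n) => singVal L i)
    (orthonormal_euclideanCol hA.left_orthonormal)
    (orthonormal_euclideanCol hA.right_orthonormal)
    (orthonormal_euclideanCol hL.left_orthonormal)
    (orthonormal_euclideanCol hL.right_orthonormal)
    (fun i j hij => singVal_antitone A hij) (fun i j hij => singVal_antitone L hij)
    (fun i => singVal_nonneg A i) (fun i => singVal_nonneg L i)
    hA.toEuclideanLin_apply hL.toEuclideanLin_apply d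
  rwa [← map_sub, ← Matrix.l2_opNorm_def] at h

theorem IsSVD.abs_singVal_sub_le (hA : IsSVD A U V) (hL : IsSVD L U' V') (d : Fin (min m n)) :
    |singVal A d - singVal L d| ≤ ‖A - L‖ := by
  have h1 := hA.singVal_le_add_norm_sub hL d
  have h2 := hL.singVal_le_add_norm_sub hA d
  rw [norm_sub_rev] at h2
  rw [abs_le]
  constructor <;> linarith

/-- Hard thresholding at the rank of the target at most doubles the error. -/
theorem IsSVD.norm_hardThreshold_sub_le (hA : IsSVD A U V) (hL : IsSVD L U' V') :
    ‖hardThreshold L.rank A U V - L‖ ≤ 2 * ‖A - L‖ := by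
  have h1 : hardThreshold L.rank A U V - A = U * Matrix.diagonal (fun i : Fin (min m n) =>
      (if (i : ℕ) < L.rank then singVal A i else 0) - singVal A i) * Vᵀ := by
    rw [← Matrix.diagonal_sub, Matrix.mul_sub, Matrix.sub_mul, ← hA.eq_mul]
    rfl
  -- Each discarded singular value lies beyond the rank of `L`, so Weyl compares it with zero.
  have h2 : ‖hardThreshold L.rank A U V - A‖ ≤ ‖A - L‖ := by
    rw [h1]
    refine l2_opNorm_mul_diagonal_mul_transpose_le hA.left_orthonormal hA.right_orthonormal
      (norm_nonneg _) fun i => ?_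
    split_ifs with hi
    · simp
    · rw [zero_sub, abs_neg, abs_of_nonneg (singVal_nonneg A i)]
      have := hA.singVal_le_add_norm_sub hL i
      rwa [(singVal_eq_zero_iff L i).2 (not_lt.1 hi), zero_add] at this
  have h3 := norm_add_le (hardThreshold L.rank A U V - A) (A - L)
  rw [sub_add_sub_cancel] at h3
  linarith

theorem sum_castLE_of_eq_zero {M : Type*} [AddCommMonoid M] {r k : ℕ} (h : r ≤ k)
    {f : Fin k → M} (hf : ∀ i : Fin k, r ≤ (i : ℕ) → f i = 0) :
    ∑ i, f i = ∑ i : Fin r, f (Fin.castLE h i) := by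
  refine (Finset.sum_of_injOn (Fin.castLE h) (Fin.castLE_injective h).injOn (by simp)
    ?_ (fun i _ => rfl)).symm
  intro j _ hj
  refine hf j ?_
  by_contra hlt
  exact hj ⟨⟨j, not_le.1 hlt⟩, by simp, rfl⟩

theorem abs_le_entryNorm (M : Matrix (Fin m) (Fin n) ℝ) (i : Fin m) (j : Fin n) :
    |M i j| ≤ entryNorm M :=
  (le_ciSup (f := fun j => |M i j|) (Set.finite_range _).bddAbove j).trans
    (le_ciSup (f := fun i => ⨆ j, |M i j|) (Set.finite_range _).bddAbove i)

theorem entryNorm_nonneg (M : Matrix (Fin m) (Fin n) ℝ) : 0 ≤ entryNorm M :=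
  Real.iSup_nonneg fun _ => Real.iSup_nonneg fun _ => abs_nonneg _

theorem entryNorm_le {M : Matrix (Fin m) (Fin n) ℝ} {b : ℝ} (hb : 0 ≤ b)
    (h : ∀ i j, |M i j| ≤ b) : entryNorm M ≤ b :=
  Real.iSup_le (fun i => Real.iSup_le (h i) hb) hb

theorem norm_col_le_entryNorm (M : Matrix (Fin m) (Fin n) ℝ) (j : Fin n) :
    ‖M.col j‖ ≤ entryNorm M :=
  (pi_norm_le_iff_of_nonneg (entryNorm_nonneg M)).2 fun i => abs_le_entryNorm M i j

/-- Cauchy-Schwarz on a row, whose Euclidean norm is at most `√n` times its largest entry. Every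
`√N₁` in the sup-norm estimate arises here. -/
theorem abs_toEuclideanLin_apply_le (M : Matrix (Fin m) (Fin n) ℝ)
    (x : EuclideanSpace ℝ (Fin n)) (j : Fin m) :
    |Matrix.toEuclideanLin M x j| ≤ √(n : ℝ) * entryNorm M * ‖x‖ := by
  have h1 : Matrix.toEuclideanLin M x j = ⟪WithLp.toLp 2 (M j), x⟫ := by
    rw [ofLp_toEuclideanLin, ← WithLp.toLp_ofLp 2 x,
      EuclideanSpace.inner_toLp_toLp, dotProduct_comm]
    rfl
  have h2 : ‖WithLp.toLp 2 (M j)‖ ≤ √(n : ℝ) * entryNorm M := by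
    rw [EuclideanSpace.norm_eq, ← Real.sqrt_sq (entryNorm_nonneg M), ← Real.sqrt_mul (by simp)]
    refine Real.sqrt_le_sqrt ?_
    calc ∑ i, ‖M j i‖ ^ 2 ≤ ∑ _i : Fin n, entryNorm M ^ 2 := by
          refine Finset.sum_le_sum fun i _ => ?_
          have := abs_le_entryNorm M j i
          rw [Real.norm_eq_abs]
          gcongr
      _ = n * entryNorm M ^ 2 := by simp
  rw [h1]
  exact (abs_real_inner_le_norm _ _).trans (by gcongr)

end MatrixLemmas

/-! ### Gaps and deterministic bounds for individual singular vectors. -/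

section ColumnBounds

variable {m n : ℕ}

theorem abs_gap_le_maxGap (L : Matrix (Fin m) (Fin n) ℝ) {r : ℕ} (i : Fin r) :
    |singVal L i - singVal L (i + 1)| ≤ maxGap r L :=
  le_ciSup (f := fun i : Fin r => |singVal L i - singVal L (i + 1)|)
    (Set.finite_range _).bddAbove i

theorem minGap_le_abs_gap (L : Matrix (Fin m) (Fin n) ℝ) {r : ℕ} (i : Fin r) :
    minGap r L ≤ |singVal L i - singVal L (i + 1)| :=
  ciInf_le (f := fun i : Fin r => |singVal L i - singVal L (i + 1)|)
    (Set.finite_range _).bddBelow i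

theorem maxGap_nonneg (r : ℕ) (L : Matrix (Fin m) (Fin n) ℝ) : 0 ≤ maxGap r L :=
  Real.iSup_nonneg fun _ => abs_nonneg _

theorem minGap_nonneg (r : ℕ) (L : Matrix (Fin m) (Fin n) ℝ) : 0 ≤ minGap r L :=
  Real.iInf_nonneg fun _ => abs_nonneg _

/-- Supplies both separations needed for the perturbation of a pair: between two spikes, and, with
`j = i + 1` and nonnegativity, of each spike from zero. -/
theorem minGap_le_sub (L : Matrix (Fin m) (Fin n) ℝ) {r i j : ℕ} (hi : i < r) (hij : i < j) :
    minGap r L ≤ singVal L i - singVal L j := by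
  have h1 := minGap_le_abs_gap L ⟨i, hi⟩
  rw [abs_of_nonneg (sub_nonneg.2 (singVal_antitone L (Nat.le_succ i)))] at h1
  exact h1.trans (sub_le_sub_left (singVal_antitone L hij) _)

/-- The largest gap of a nonzero matrix is positive, as its last spike is separated from zero. -/
theorem maxGap_rank_pos (L : Matrix (Fin m) (Fin n) ℝ) (h : 0 < L.rank) :
    0 < maxGap L.rank L := by
  refine lt_of_lt_of_le ?_ (abs_gap_le_maxGap L ⟨L.rank - 1, by omega⟩)
  have h1 : singVal L (L.rank - 1 + 1) = 0 := (singVal_eq_zero_iff L _).2 (by omega)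
  have h2 : singVal L (L.rank - 1) ≠ 0 := fun h0 => by
    have := (singVal_eq_zero_iff L _).1 h0
    omega
  change 0 < |singVal L (L.rank - 1) - singVal L (L.rank - 1 + 1)|
  rw [h1, sub_zero]
  exact abs_pos.2 h2

variable {A L : Matrix (Fin m) (Fin n) ℝ} {U Uh : Matrix (Fin m) (Fin (min m n)) ℝ}
  {V Vh : Matrix (Fin n) (Fin (min m n)) ℝ} {r : ℕ}

theorem IsSVD.toEuclideanLin_apply_of_rank_le (hL : IsSVD L U V) (hr : r ≤ min m n)
    (hrank : L.rank ≤ r) (y : EuclideanSpace ℝ (Fin n)) :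
    Matrix.toEuclideanLin L y = ∑ i : Fin r,
      (singVal L i * ⟪euclideanCol (leadingCols hr V) i, y⟫) •
        euclideanCol (leadingCols hr U) i := by
  rw [hL.toEuclideanLin_apply, sum_castLE_of_eq_zero hr]
  · rfl
  · intro i hi
    rw [(singVal_eq_zero_iff L i).2 (hrank.trans hi)]
    simp

theorem IsSVD.toEuclideanLin_transpose_apply_of_rank_le (hL : IsSVD L U V) (hr : r ≤ min m n)
    (hrank : L.rank ≤ r) (x : EuclideanSpace ℝ (Fin m)) :
    Matrix.toEuclideanLin Lᵀ x = ∑ i : Fin r,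
      (singVal L i * ⟪euclideanCol (leadingCols hr U) i, x⟫) •
        euclideanCol (leadingCols hr V) i := by
  rw [hL.toEuclideanLin_transpose_apply, sum_castLE_of_eq_zero hr]
  · rfl
  · intro i hi
    rw [(singVal_eq_zero_iff L i).2 (hrank.trans hi)]
    simp

theorem orthonormal_leadingCols {k : ℕ} {W : Matrix (Fin m) (Fin k) ℝ} (h : Wᵀ * W = 1)
    (hr : r ≤ k) : Orthonormal ℝ (euclideanCol (leadingCols hr W)) :=
  (orthonormal_euclideanCol h).comp _ (Fin.castLE_injective hr)

theorem IsSVD.leading_perturbation (hA : IsSVD A Uh Vh) (hL : IsSVD L U V) (hr : r ≤ min m n)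
    (hrank : L.rank ≤ r) {e : ℝ} (he : ‖A - L‖ ≤ e) (hmin : 0 < minGap r L)
    (hem : (6 * r + 4) * e ≤ minGap r L) (d : Fin r)
    (hsign : 0 ≤ ⟪euclideanCol (leadingCols hr U) d, euclideanCol (leadingCols hr Uh) d⟫) :
    (∀ i, i ≠ d → |⟪euclideanCol (leadingCols hr V) i, euclideanCol (leadingCols hr Vh) d⟫| ≤
        4 * (e / minGap r L)) ∧
      ‖euclideanCol (leadingCols hr Uh) d - euclideanCol (leadingCols hr U) d‖ ≤
        (12 * r + 4) * (e / minGap r L) ∧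
      ‖euclideanCol (leadingCols hr Vh) d - euclideanCol (leadingCols hr V) d‖ ≤
        (12 * r + 4) * (e / minGap r L) := by
  have hUh := (orthonormal_leadingCols hA.left_orthonormal hr).1 d
  have hVh := (orthonormal_leadingCols hA.right_orthonormal hr).1 d
  refine singularPair_norm_sub_le (orthonormal_leadingCols hL.left_orthonormal hr)
    (orthonormal_leadingCols hL.right_orthonormal hr) (σ := fun i => singVal L i)
    (s := singVal A d)
    (p := Matrix.toEuclideanLin (A - L) (euclideanCol (leadingCols hr Vh) d))
    (q := Matrix.toEuclideanLin (A - L)ᵀ (euclideanCol (leadingCols hr Uh) d))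
    hmin ?_ ?_ ((hA.abs_singVal_sub_le hL (Fin.castLE hr d)).trans he) hem ?_ ?_ ?_ ?_ hUh hVh
    hsign
  · intro i hi
    rcases lt_or_gt_of_ne hi with h | h
    · rw [abs_sub_comm]
      exact (minGap_le_sub L i.2 h).trans (le_abs_self _)
    · exact (minGap_le_sub L d.2 h).trans (le_abs_self _)
  · intro i
    have := minGap_le_sub L i.2 (Nat.lt_succ_self i)
    linarith [singVal_nonneg L (i + 1)]
  · rw [← hL.toEuclideanLin_apply_of_rank_le hr hrank, ← LinearMap.add_apply, ← map_add,
      add_sub_cancel]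
    exact (hA.toEuclideanLin_col (Fin.castLE hr d)).symm
  · rw [← hL.toEuclideanLin_transpose_apply_of_rank_le hr hrank, ← LinearMap.add_apply,
      ← map_add, ← Matrix.transpose_add, add_sub_cancel]
    exact (hA.toEuclideanLin_transpose_col (Fin.castLE hr d)).symm
  · refine (norm_toEuclideanLin_le _ _).trans ?_
    rwa [hVh, mul_one]
  · refine (norm_toEuclideanLin_le _ _).trans ?_
    rwa [hUh, mul_one, l2_opNorm_transpose]

/-- The sup-norm perturbation bound for a leading left singular vector. -/
theorem IsSVD.norm_col_sub_le (hA : IsSVD A Uh Vh) (hL : IsSVD L U V) (hr : r ≤ min m n)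
    (hrank : L.rank ≤ r) (S : Matrix (Fin m) (Fin n) ℝ) {e : ℝ} (he : ‖A - L‖ ≤ e)
    (hmin : 0 < minGap r L) (hem : (6 * r + 4) * e ≤ minGap r L) (d : Fin r)
    (hsign : 0 ≤ ⟪euclideanCol (leadingCols hr U) d, euclideanCol (leadingCols hr Uh) d⟫) :
    ‖(leadingCols hr Uh).col d - (leadingCols hr U).col d‖ ≤
      2 * ((16 * r + 5) * (√(n : ℝ) * (entryNorm S + entryNorm L)) * (e / minGap r L)
        + ‖S *ᵥ (leadingCols hr V).col d‖ + √(n : ℝ) * entryNorm (A - (L + S)))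
        / minGap r L := by
  obtain ⟨hoff, -, hV⟩ := hA.leading_perturbation hL hr hrank he hmin hem d hsign
  have hUo := orthonormal_leadingCols hL.left_orthonormal hr
  have hVo := orthonormal_leadingCols hL.right_orthonormal hr
  set u := euclideanCol (leadingCols hr U) with hu
  set v := euclideanCol (leadingCols hr V) with hv
  set x := euclideanCol (leadingCols hr Uh) d with hx
  set y := euclideanCol (leadingCols hr Vh) d with hy
  set g := minGap r L with hg
  set s := singVal A d with hs
  have he0 : 0 ≤ e := (norm_nonneg _).trans he
  have hye : ‖y‖ = 1 := (orthonormal_leadingCols hA.right_orthonormal hr).1 d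
  have hS0 := entryNorm_nonneg S
  have hL0 := entryNorm_nonneg L
  have hε : 0 ≤ e / g := by positivity
  have hweyl : |s - singVal L d| ≤ e :=
    (hA.abs_singVal_sub_le hL (Fin.castLE hr d)).trans he
  have hd : g ≤ singVal L d := by
    have := minGap_le_sub L d.2 (Nat.lt_succ_self d)
    linarith [singVal_nonneg L (d + 1)]
  have hem2 : 2 * e ≤ g := by
    have : 0 ≤ r * e := by positivity
    linarith
  have hsg : g / 2 ≤ s := by
    rw [abs_le] at hweyl
    linarith
  have hs0 : 0 < s := by linarith
  -- `σ i u i = L v i` is bounded entrywise even though `u i` alone need not be.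
  have hLu : ∀ (i : Fin r) (j : Fin m), |singVal L i * u i j| ≤ √(n : ℝ) * entryNorm L := by
    intro i j
    have h1 := abs_toEuclideanLin_apply_le L (v i) j
    rw [hVo.1 i, mul_one] at h1
    have h2 : Matrix.toEuclideanLin L (v i) = singVal L i • u i :=
      hL.toEuclideanLin_col (Fin.castLE hr i)
    rwa [h2] at h1
  -- Comparing with `s / σ d` instead of `1` makes the subtracted term exactly `s u d` after
  -- multiplication by `σ d u d`.
  have hdiag : |⟪v d, y⟫ - s / singVal L d| ≤ (12 * r + 5) * (e / g) := by
    have hp : 0 < singVal L d := by linarith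
    have h1 : |⟪v d, y⟫ - 1| ≤ (12 * r + 4) * (e / g) := by
      have h2 : ⟪v d, y⟫ - 1 = ⟪v d, y - v d⟫ := by
        rw [inner_sub_right, real_inner_self_eq_norm_sq, hVo.1 d]; norm_num
      rw [h2]
      exact (abs_inner_le_of_orthonormal hVo d _).trans hV
    have h3 : |s / singVal L d - 1| ≤ e / g := by
      rw [div_sub_one hp.ne', abs_div, abs_of_pos hp]
      gcongr
    have h4 : ⟪v d, y⟫ - s / singVal L d = (⟪v d, y⟫ - 1) - (s / singVal L d - 1) := by ring
    rw [h4]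
    linarith [abs_sub (⟪v d, y⟫ - 1) (s / singVal L d - 1)]
  have hentry : ∀ j : Fin m, s * |x j - u d j| ≤
      (16 * r + 5) * (√(n : ℝ) * (entryNorm S + entryNorm L)) * (e / g)
        + ‖S *ᵥ (leadingCols hr V).col d‖ + √(n : ℝ) * entryNorm (A - (L + S)) := by
    intro j
    have h1 : s • x = Matrix.toEuclideanLin L y + Matrix.toEuclideanLin S (v d)
        + Matrix.toEuclideanLin S (y - v d) + Matrix.toEuclideanLin (A - (L + S)) y := by
      have h2 : s • x = Matrix.toEuclideanLin A y :=
        (hA.toEuclideanLin_col (Fin.castLE hr d)).symm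
      rw [h2]
      simp only [map_sub, map_add, LinearMap.sub_apply, LinearMap.add_apply]
      abel
    have h2 : Matrix.toEuclideanLin L y j = ∑ i : Fin r, ⟪v i, y⟫ * (singVal L i * u i j) := by
      rw [hL.toEuclideanLin_apply_of_rank_le hr hrank y]
      simp only [WithLp.ofLp_sum, WithLp.ofLp_smul, Finset.sum_apply, Pi.smul_apply, smul_eq_mul]
      exact Finset.sum_congr rfl fun i _ => by rw [← hu, ← hv]; ring
    have h3 : s * (x j - u d j) = (⟪v d, y⟫ - s / singVal L d) * (singVal L d * u d j)
        + ∑ i ∈ Finset.univ.erase d, ⟪v i, y⟫ * (singVal L i * u i j)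
        + Matrix.toEuclideanLin S (v d) j + Matrix.toEuclideanLin S (y - v d) j
        + Matrix.toEuclideanLin (A - (L + S)) y j := by
      have h4 : s * x j = (s • x).ofLp j := rfl
      have h5 : s / singVal L d * (singVal L d * u d j) = s * u d j := by
        rw [← mul_assoc, div_mul_cancel₀ _ (by linarith : singVal L d ≠ 0)]
      rw [mul_sub, h4, h1, sub_mul, h5]
      simp only [PiLp.add_apply]
      rw [h2, ← Finset.add_sum_erase _ _ (Finset.mem_univ d)]
      ring
    have b1 : |(⟪v d, y⟫ - s / singVal L d) * (singVal L d * u d j)| ≤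
        (12 * r + 5) * (e / g) * (√(n : ℝ) * entryNorm L) := by
      rw [abs_mul]
      have := hLu d j
      gcongr
    have b2 : |∑ i ∈ Finset.univ.erase d, ⟪v i, y⟫ * (singVal L i * u i j)| ≤
        r * (4 * (e / g) * (√(n : ℝ) * entryNorm L)) := by
      calc _ ≤ ∑ i ∈ Finset.univ.erase d, 4 * (e / g) * (√(n : ℝ) * entryNorm L) := by
            refine (Finset.abs_sum_le_sum_abs _ _).trans (Finset.sum_le_sum fun i hi => ?_)
            rw [abs_mul]
            have h6 := hLu i j
            have h7 := hoff i (Finset.ne_of_mem_erase hi)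
            gcongr
        _ = ((Finset.univ.erase d).card : ℝ) * (4 * (e / g) * (√(n : ℝ) * entryNorm L)) := by
            simp
        _ ≤ _ := by
            gcongr
            simp
    have b3 : |Matrix.toEuclideanLin S (v d) j| ≤ ‖S *ᵥ (leadingCols hr V).col d‖ :=
      norm_le_pi_norm (S *ᵥ (leadingCols hr V).col d) j
    have b4 : |Matrix.toEuclideanLin S (y - v d) j| ≤
        √(n : ℝ) * entryNorm S * ((12 * r + 4) * (e / g)) :=
      (abs_toEuclideanLin_apply_le S _ j).trans (by gcongr)
    have b5 : |Matrix.toEuclideanLin (A - (L + S)) y j| ≤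
        √(n : ℝ) * entryNorm (A - (L + S)) := by
      have := abs_toEuclideanLin_apply_le (A - (L + S)) y j
      rwa [hye, mul_one] at this
    -- Slack raising the coefficient `12 r + 4` of the `S` term to the `16 r + 5` of the `L` term.
    have b6 : 0 ≤ (4 * r + 1) * (√(n : ℝ) * entryNorm S) * (e / g) := by positivity
    have h8 : s * |x j - u d j| = |s * (x j - u d j)| := by rw [abs_mul, abs_of_pos hs0]
    rw [h8, h3]
    refine (abs_add_le _ _).trans ((add_le_add_left ((abs_add_le _ _).trans
      (add_le_add_left ((abs_add_le _ _).trans (add_le_add_left (abs_add_le _ _) _)) _)) _).trans ?_)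
    linarith
  have hrhs : 0 ≤ (16 * r + 5) * (√(n : ℝ) * (entryNorm S + entryNorm L)) * (e / g)
        + ‖S *ᵥ (leadingCols hr V).col d‖ + √(n : ℝ) * entryNorm (A - (L + S)) := by
    have := entryNorm_nonneg (A - (L + S))
    positivity
  refine (pi_norm_le_iff_of_nonneg (by positivity)).2 fun j => ?_
  rw [le_div_iff₀ hmin]
  have h1 := hentry j
  have h2 : g / 2 * |x j - u d j| ≤ s * |x j - u d j| := by gcongr
  change |x j - u d j| * g ≤ _
  linarith

end ColumnBounds

/-! ### From minimal gaps to rates in terms of the maximal gap. -/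

section Rates

variable {m n r : ℕ}

/-- The deterministic event on which the perturbation bounds hold. -/
structure PerturbationRegime (r : ℕ) (A L S : Matrix (Fin m) (Fin n) ℝ) (η C δ : ℝ) : Prop where
  rank_eq : L.rank = r
  norm_sub_le : ‖A - (L + S)‖ ≤ C * η
  gap_le : maxGap r L ≤ C * minGap r L
  small : η + ‖S‖ ≤ δ * maxGap r L

variable {A L S : Matrix (Fin m) (Fin n) ℝ} {U Uh : Matrix (Fin m) (Fin (min m n)) ℝ}
  {V Vh : Matrix (Fin n) (Fin (min m n)) ℝ} {η C δ : ℝ} {R : ℕ}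

theorem PerturbationRegime.norm_sub_spike_le (h : PerturbationRegime r A L S η C δ) (hC : 1 ≤ C) :
    ‖A - L‖ ≤ C * (η + ‖S‖) := by
  have h1 : A - L = (A - (L + S)) + S := by abel
  have h2 : ‖S‖ ≤ C * ‖S‖ := le_mul_of_one_le_left (norm_nonneg _) hC
  rw [h1]
  linarith [norm_add_le (A - (L + S)) S, h.norm_sub_le]

theorem PerturbationRegime.maxGap_pos (h : PerturbationRegime r A L S η C δ) (hr : 0 < r) :
    0 < maxGap r L := by
  obtain rfl := h.rank_eq
  exact maxGap_rank_pos L hr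

theorem PerturbationRegime.minGap_pos (h : PerturbationRegime r A L S η C δ) (hr : 0 < r)
    (hC : 1 ≤ C) : 0 < minGap r L :=
  pos_of_mul_pos_right ((h.maxGap_pos hr).trans_le h.gap_le) (by linarith)

/-- The smallness condition and gap comparability give `η + ‖S‖ ≤ δ C · minGap`; `δ` is normalized
so that this is the smallness required by the singular pair bound. -/
theorem PerturbationRegime.rank_mul_le (h : PerturbationRegime r A L S η C δ) (hC : 1 ≤ C)
    (hR : r ≤ R) (hη : 0 ≤ η) (hδ : (6 * R + 4) * C ^ 2 * δ = 1) :
    (6 * r + 4) * (C * (η + ‖S‖)) ≤ minGap r L := by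
  have hR' : (r : ℝ) ≤ R := by exact_mod_cast hR
  have hδ0 : 0 ≤ δ := by
    by_contra hneg
    have : (6 * R + 4) * C ^ 2 * δ ≤ 0 :=
      mul_nonpos_of_nonneg_of_nonpos (by positivity) (not_le.1 hneg).le
    linarith
  calc (6 * r + 4) * (C * (η + ‖S‖)) ≤ (6 * R + 4) * (C * (δ * (C * minGap r L))) := by
        have h1 : η + ‖S‖ ≤ δ * (C * minGap r L) :=
          h.small.trans (mul_le_mul_of_nonneg_left h.gap_le hδ0)
        have : 0 ≤ η + ‖S‖ := add_nonneg hη (norm_nonneg _)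
        gcongr
    _ = ((6 * R + 4) * C ^ 2 * δ) * minGap r L := by ring
    _ = minGap r L := by rw [hδ, one_mul]

theorem PerturbationRegime.norm_leadingCols_sub_le (h : PerturbationRegime r A L S η C δ)
    (hC : 1 ≤ C) (hR : r ≤ R) (hη : 0 ≤ η) (hδ : (6 * R + 4) * C ^ 2 * δ = 1)
    (hA : IsSVD A Uh Vh) (hL : IsSVD L U V) (hr : r ≤ min m n)
    (hsign : ∀ d : Fin r, 0 ≤ (leadingCols hr Uh).col d ⬝ᵥ (leadingCols hr U).col d) :
    ‖leadingCols hr Uh - leadingCols hr U‖ ≤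
      (R + 1) * ((12 * R + 4) * C ^ 2) * ((η + ‖S‖) / maxGap r L) := by
  have hτ : 0 ≤ η + ‖S‖ := add_nonneg hη (norm_nonneg _)
  have hR' : (r : ℝ) ≤ R := by exact_mod_cast hR
  have hg0 := maxGap_nonneg r L
  refine (l2_opNorm_le_sum_euclideanCol _).trans ?_
  calc ∑ d, ‖euclideanCol (leadingCols hr Uh - leadingCols hr U) d‖
      ≤ ∑ _d : Fin r, ((12 * R + 4) * C ^ 2) * ((η + ‖S‖) / maxGap r L) := by
        refine Finset.sum_le_sum fun d _ => ?_
        -- The column index `d` itself witnesses `0 < r`; for `r = 0` both gaps are zero by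
        -- convention, but there is no column to bound.
        have hmin := h.minGap_pos d.pos hC
        have hmax := h.maxGap_pos d.pos
        have hcol := (hA.leading_perturbation hL hr h.rank_eq.le (h.norm_sub_spike_le hC) hmin
          (h.rank_mul_le hC hR hη hδ) d
          (by rw [euclideanCol, euclideanCol, EuclideanSpace.inner_toLp_toLp]; exact hsign d)).2.1
        refine hcol.trans ?_
        have h1 : C * (η + ‖S‖) / minGap r L ≤ C ^ 2 * ((η + ‖S‖) / maxGap r L) := by
          rw [← mul_div_assoc, div_le_div_iff₀ hmin hmax]
          calc C * (η + ‖S‖) * maxGap r L ≤ C * (η + ‖S‖) * (C * minGap r L) := by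
                have := h.gap_le
                gcongr
            _ = C ^ 2 * (η + ‖S‖) * minGap r L := by ring
        calc (12 * r + 4) * (C * (η + ‖S‖) / minGap r L)
            ≤ (12 * R + 4) * (C ^ 2 * ((η + ‖S‖) / maxGap r L)) := by gcongr
          _ = _ := by ring
    _ = r * (((12 * R + 4) * C ^ 2) * ((η + ‖S‖) / maxGap r L)) := by simp
    -- `R + 1` keeps the final constant positive when `R = 0`.
    _ ≤ (R + 1) * (((12 * R + 4) * C ^ 2) * ((η + ‖S‖) / maxGap r L)) := by
        gcongr
        linarith
    _ = _ := by ring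

/-- Bookkeeping for `μ⁻¹ ≤ C g⁻¹`: the `τ` term collects `C ^ 4` from `B`, from `C τ` and from two
inverse gaps, the others at most `C ^ 2`. The quantities `a` and `w'` merely enlarge the right-hand
side. -/
theorem column_rate_le {ρ R C B τ g μ a b c c' w w' : ℝ} (hρ : 0 ≤ ρ) (hρR : ρ ≤ R) (hC : 1 ≤ C)
    (hB : 0 ≤ B) (hBC : B ≤ C) (hτ : 0 ≤ τ) (hg : 0 < g) (hμ : 0 < μ) (hgμ : g ≤ C * μ)
    (ha : 0 ≤ a) (hb : 0 ≤ b) (hc : 0 ≤ c) (hc' : c' ≤ C * c) (hw : 0 ≤ w) :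
    2 * ((16 * ρ + 5) * (b * B) * (C * τ / μ) + w + b * c') / μ ≤
      (2 * (16 * R + 5) * C ^ 4 + 2 * C ^ 2) *
        ((a + b) * τ * (g ^ 2)⁻¹ + (c * a + c * b + max w w') * g⁻¹) := by
  have hi : μ⁻¹ ≤ C * g⁻¹ := by
    rw [← div_eq_mul_inv, le_div_iff₀ hg, inv_mul_le_iff₀ hμ]
    linarith
  have hi0 : 0 < μ⁻¹ := inv_pos.2 hμ
  have hh0 : 0 < g⁻¹ := inv_pos.2 hg
  have hmax : 0 ≤ max w w' := hw.trans (le_max_left _ _)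
  have hR : 0 ≤ R := hρ.trans hρR
  have hCC : C ≤ C ^ 2 := by nlinarith
  have t1 : (16 * ρ + 5) * (b * B) * (C * τ * μ⁻¹) * μ⁻¹ ≤
      (16 * R + 5) * C ^ 4 * ((a + b) * τ * (g⁻¹) ^ 2) := by
    calc (16 * ρ + 5) * (b * B) * (C * τ * μ⁻¹) * μ⁻¹
        ≤ (16 * R + 5) * ((a + b) * C) * (C * τ * (C * g⁻¹)) * (C * g⁻¹) := by
          gcongr
          linarith
      _ = _ := by ring
  have t2 : w * μ⁻¹ ≤ C ^ 2 * (max w w' * g⁻¹) := by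
    calc w * μ⁻¹ ≤ max w w' * (C * g⁻¹) := by
          gcongr
          exact le_max_left _ _
      _ = C * (max w w' * g⁻¹) := by ring
      _ ≤ C ^ 2 * (max w w' * g⁻¹) := by gcongr
  have t3 : b * c' * μ⁻¹ ≤ C ^ 2 * ((c * a + c * b) * g⁻¹) := by
    calc b * c' * μ⁻¹ ≤ b * (C * c) * (C * g⁻¹) := by gcongr
      _ = C ^ 2 * ((c * b) * g⁻¹) := by ring
      _ ≤ C ^ 2 * ((c * a + c * b) * g⁻¹) := by
          gcongr
          have := mul_nonneg hc ha
          linarith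
  -- `t4` and `t5` are the cross terms in the product of the two sums.
  have t4 : 0 ≤ (16 * R + 5) * C ^ 4 * ((c * a + c * b + max w w') * g⁻¹) := by positivity
  have t5 : 0 ≤ C ^ 2 * ((a + b) * τ * (g⁻¹) ^ 2) := by positivity
  rw [div_eq_mul_inv, div_eq_mul_inv, ← inv_pow]
  linarith

theorem PerturbationRegime.norm_col_sub_le (h : PerturbationRegime r A L S η C δ)
    (hC : 1 ≤ C) (hR : r ≤ R) (hη : 0 ≤ η) (hδ : (6 * R + 4) * C ^ 2 * δ = 1)
    (hA : IsSVD A Uh Vh) (hL : IsSVD L U V) (hr : r ≤ min m n)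
    (hsign : ∀ d : Fin r, 0 ≤ (leadingCols hr Uh).col d ⬝ᵥ (leadingCols hr U).col d)
    {c : ℝ} (hc : 0 ≤ c) (hentry : entryNorm (A - (L + S)) ≤ C * c)
    (hbdd : entryNorm S + entryNorm L ≤ C) (d : Fin r) {a : ℝ} (ha : 0 ≤ a) (w' : ℝ) :
    ‖(leadingCols hr Uh).col d - (leadingCols hr U).col d‖ ≤
      (2 * (16 * R + 5) * C ^ 4 + 2 * C ^ 2) *
        ((a + √(n : ℝ)) * (η + ‖S‖) * (maxGap r L ^ 2)⁻¹ +
          (c * a + c * √(n : ℝ) + max ‖S *ᵥ (leadingCols hr V).col d‖ w') * (maxGap r L)⁻¹) := by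
  have hmin := h.minGap_pos d.pos hC
  refine (hA.norm_col_sub_le hL hr h.rank_eq.le S (h.norm_sub_spike_le hC) hmin
    (h.rank_mul_le hC hR hη hδ) d
    (by rw [euclideanCol, euclideanCol, EuclideanSpace.inner_toLp_toLp]; exact hsign d)).trans ?_
  exact column_rate_le r.cast_nonneg (by exact_mod_cast hR) hC
    (add_nonneg (entryNorm_nonneg _) (entryNorm_nonneg _)) hbdd
    (add_nonneg hη (norm_nonneg _)) (h.maxGap_pos d.pos) hmin h.gap_le ha (Real.sqrt_nonneg _) hc
    hentry (norm_nonneg _)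

end Rates

/-! ### Reduction of stochastic orders to events of high probability. -/

section StochasticOrder

variable {Ω : Type*} [MeasurableSpace Ω] {P : Measure Ω} {X Y : ℕ → Ω → ℝ}

/-- Allowing every larger `C` lets several such bounds share one constant. -/
theorem IsBigOP.eventually_not_le (h : IsBigOP P X Y) {ε : ℝ} (hε : 0 < ε) :
    ∃ C₀ : ℝ, ∀ C, C₀ ≤ C →
      ∀ᶠ N in atTop, P {ω | ¬ |X N ω| ≤ C * |Y N ω|} ≤ ENNReal.ofReal ε := by
  obtain ⟨C₀, -, h₀⟩ := h ε hε
  refine ⟨C₀, fun C hC => h₀.mono fun N hN => (measure_mono fun ω hω => ?_).trans hN⟩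
  exact (mul_le_mul_of_nonneg_right hC (abs_nonneg _)).trans_lt (not_le.1 hω)

theorem IsLittleOP.eventually_not_le (h : IsLittleOP P X Y) {δ ε : ℝ} (hδ : 0 < δ) (hε : 0 < ε) :
    ∀ᶠ N in atTop, P {ω | ¬ |X N ω| ≤ δ * |Y N ω|} ≤ ENNReal.ofReal ε := by
  simp_rw [not_le]
  exact (h δ hδ).eventually_le_const (ENNReal.ofReal_pos.2 hε)

theorem measure_not_and_le {p q : Ω → Prop} {a b : ℝ} (ha : 0 ≤ a) (hb : 0 ≤ b)
    (hp : P {ω | ¬ p ω} ≤ ENNReal.ofReal a) (hq : P {ω | ¬ q ω} ≤ ENNReal.ofReal b) :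
    P {ω | ¬ (p ω ∧ q ω)} ≤ ENNReal.ofReal (a + b) := by
  rw [ENNReal.ofReal_add ha hb]
  refine (measure_mono fun ω hω => ?_).trans ((measure_union_le _ _).trans (add_le_add hp hq))
  exact not_and_or.1 hω

theorem IsBigOP.of_event (h : ∀ ε : ℝ, 0 < ε → ∃ G : ℕ → Ω → Prop,
    (∀ᶠ N in atTop, P {ω | ¬ G N ω} ≤ ENNReal.ofReal ε) ∧
      ∃ K : ℝ, 0 < K ∧ ∀ N ω, G N ω → |X N ω| ≤ K * |Y N ω|) : IsBigOP P X Y := by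
  intro ε hε
  obtain ⟨G, hG, K, hK, hGK⟩ := h ε hε
  refine ⟨K, hK, hG.mono fun N hN => (measure_mono fun ω hω hg => ?_).trans hN⟩
  exact absurd (hGK N ω hg) (not_le.2 hω)

theorem IsBigOPUnif.of_event {r : ℕ → ℕ} {X Y : ∀ N, Fin (r N) → Ω → ℝ}
    (h : ∀ ε : ℝ, 0 < ε → ∃ G : ℕ → Ω → Prop,
    (∀ᶠ N in atTop, P {ω | ¬ G N ω} ≤ ENNReal.ofReal ε) ∧
      ∃ K : ℝ, 0 < K ∧ ∀ N ω, G N ω → ∀ d, |X N d ω| ≤ K * |Y N d ω|) :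
    IsBigOPUnif P X Y := by
  intro ε hε
  obtain ⟨G, hG, K, hK, hGK⟩ := h ε hε
  refine ⟨K, hK, hG.mono fun N hN => (measure_mono fun ω hω hg => ?_).trans hN⟩
  obtain ⟨d, hd⟩ := hω
  exact absurd (hGK N ω hg d) (not_le.2 hd)

/-- A union bound: three events cost `ε / 3` each and the rank condition costs nothing. The
quantifier order lets `δ` depend on `C`, as the `o_P` hypothesis permits any `δ`. -/
theorem exists_perturbationRegime {N₁ r : ℕ → ℕ} {A L S : ∀ N, Ω → Matrix (Fin N) (Fin (N₁ N)) ℝ}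
    (hrank : ∀ N, ∀ᵐ ω ∂P, (L N ω).rank = r N)
    {η : ℕ → Ω → ℝ} (hη : ∀ N ω, 0 ≤ η N ω)
    (hgap : IsBigOP P (fun N ω => maxGap (r N) (L N ω)) (fun N ω => minGap (r N) (L N ω)))
    (hop : IsBigOP P (fun N ω => ‖A N ω - (L N ω + S N ω)‖) η)
    (hspike : IsLittleOP P (fun N ω => η N ω + ‖S N ω‖) (fun N ω => maxGap (r N) (L N ω)))
    {ε : ℝ} (hε : 0 < ε) :
    ∃ C₀ : ℝ, ∀ C, C₀ ≤ C → ∀ δ, 0 < δ → ∀ᶠ N in atTop,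
      P {ω | ¬ PerturbationRegime (r N) (A N ω) (L N ω) (S N ω) (η N ω) C δ} ≤
        ENNReal.ofReal ε := by
  have hε3 : 0 < ε / 3 := by positivity
  obtain ⟨C₁, h₁⟩ := hgap.eventually_not_le hε3
  obtain ⟨C₂, h₂⟩ := hop.eventually_not_le hε3
  refine ⟨max C₁ C₂, fun C hC δ hδ => ?_⟩
  filter_upwards [h₁ C ((le_max_left _ _).trans hC), h₂ C ((le_max_right _ _).trans hC),
    hspike.eventually_not_le hδ hε3] with N hN₁ hN₂ hN₃
  have h0 : P {ω | ¬ (L N ω).rank = r N} ≤ ENNReal.ofReal 0 := by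
    rw [ENNReal.ofReal_zero]
    exact (ae_iff.1 (hrank N)).le
  have hall := measure_not_and_le (by positivity) hε3.le (measure_not_and_le (by positivity) hε3.le
    (measure_not_and_le le_rfl hε3.le h0 hN₁) hN₂) hN₃
  rw [show 0 + ε / 3 + ε / 3 + ε / 3 = ε by ring] at hall
  refine hall.trans' (measure_mono fun ω => mt ?_)
  rintro ⟨⟨⟨g0, g1⟩, g2⟩, g3⟩
  rw [abs_of_nonneg (maxGap_nonneg _ _), abs_of_nonneg (minGap_nonneg _ _)] at g1
  rw [abs_of_nonneg (norm_nonneg _), abs_of_nonneg (hη N ω)] at g2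
  rw [abs_of_nonneg (add_nonneg (hη N ω) (norm_nonneg _)), abs_of_nonneg (maxGap_nonneg _ _)] at g3
  exact ⟨g0, g2, g1, g3⟩

end StochasticOrder
end SpikedLowRank

/-! ### Assembly of the stochastic statements. -/

open SpikedLowRank in
theorem theorem1
    {Ω : Type*} [MeasurableSpace Ω] (P : Measure Ω) [IsProbabilityMeasure P]
    -- dimensions `N × N₁` and the (bounded) rank
    (N₁ r : ℕ → ℕ) (hr : ∀ N, r N ≤ min N (N₁ N)) (hr_bdd : ∃ R, ∀ N, r N ≤ R)
    -- the model `Σ = L + S` and the estimator of `Σ`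
    (Sig L S Sighat : ∀ N, Ω → Matrix (Fin N) (Fin (N₁ N)) ℝ)
    (hmodel : ∀ N ω, Sig N ω = L N ω + S N ω)
    (hrank : ∀ N, ∀ᵐ ω ∂P, (L N ω).rank = r N)
    -- singular value decompositions of `L` and of the estimator
    (U Uhat : ∀ N, Ω → Matrix (Fin N) (Fin (min N (N₁ N))) ℝ)
    (V Vhat : ∀ N, Ω → Matrix (Fin (N₁ N)) (Fin (min N (N₁ N))) ℝ)
    (hsvd : ∀ N ω, IsSVD (L N ω) (U N ω) (V N ω))
    (hsvd_hat : ∀ N ω, IsSVD (Sighat N ω) (Uhat N ω) (Vhat N ω))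
    -- the leading singular vectors
    (ξ ξhat : ∀ N, Ω → Matrix (Fin N) (Fin (r N)) ℝ)
    (ζ : ∀ N, Ω → Matrix (Fin (N₁ N)) (Fin (r N)) ℝ)
    (hξ : ∀ N ω, ξ N ω = leadingCols (hr N) (U N ω))
    (hξhat : ∀ N ω, ξhat N ω = leadingCols (hr N) (Uhat N ω))
    (hζ : ∀ N ω, ζ N ω = leadingCols (hr N) (V N ω))
    -- the sign of each estimated singular vector is chosen to match its target
    (hsign : ∀ N ω (d : Fin (r N)), 0 ≤ (ξhat N ω).col d ⬝ᵥ (ξ N ω).col d)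
    -- the singular value gaps are all of the order of `g`
    (g : ℕ → Ω → ℝ) (hg : ∀ N ω, g N ω = maxGap (r N) (L N ω))
    (hgap : IsBigOP P g (fun N ω => minGap (r N) (L N ω)))
    -- the rates
    (η c : ℕ → Ω → ℝ) (hη : ∀ N ω, 0 ≤ η N ω) (hc : ∀ N ω, 0 ≤ c N ω)
    (hop : IsBigOP P (fun N ω => ‖Sighat N ω - Sig N ω‖) η)
    (hentry : IsBigOP P (fun N ω => entryNorm (Sighat N ω - Sig N ω)) c)
    (hspike : IsLittleOP P (fun N ω => η N ω + ‖S N ω‖) g) :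
    -- (i)
    (IsBigOP P (fun N ω => ‖hardThreshold (r N) (Sighat N ω) (Uhat N ω) (Vhat N ω) - L N ω‖)
        (fun N ω => η N ω + ‖S N ω‖) ∧
      IsBigOP P (fun N ω => ‖ξhat N ω - ξ N ω‖)
        (fun N ω => (η N ω + ‖S N ω‖) / g N ω)) ∧
    -- (ii)
    (IsBigOP P (fun N ω => entryNorm (S N ω) + entryNorm (L N ω)) (fun _ _ => 1) →
      IsLittleOP P (fun N ω => (N₁ N : ℝ) * c N ω) g →
      -- bound for the whole matrix, the right-hand side being maximized over the columns
      IsBigOP P (fun N ω => entryNorm (ξhat N ω - ξ N ω))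
        (fun N ω =>
          ((N₁ N : ℝ) / √(N : ℝ) + √(N₁ N : ℝ)) * (η N ω + ‖S N ω‖) * ((g N ω) ^ 2)⁻¹
          + (c N ω * ((N₁ N : ℝ) / √(N : ℝ)) + c N ω * √(N₁ N : ℝ)
              + max (entryNorm (S N ω * ζ N ω)) (entryNorm ((S N ω)ᵀ * ξ N ω))) * (g N ω)⁻¹) ∧
      -- bound for each column `d`, uniformly in `d`
      IsBigOPUnif P (r := r) (fun N d ω => ‖(ξhat N ω).col d - (ξ N ω).col d‖)
        (fun N d ω =>
          ((N₁ N : ℝ) / √(N : ℝ) + √(N₁ N : ℝ)) * (η N ω + ‖S N ω‖) * ((g N ω) ^ 2)⁻¹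
          + (c N ω * ((N₁ N : ℝ) / √(N : ℝ)) + c N ω * √(N₁ N : ℝ)
              + max ‖S N ω *ᵥ (ζ N ω).col d‖ ‖(S N ω)ᵀ *ᵥ (ξ N ω).col d‖) * (g N ω)⁻¹)) := by
  obtain ⟨R, hR⟩ := hr_bdd
  obtain rfl : g = fun N ω => maxGap (r N) (L N ω) := funext₂ hg
  obtain rfl : Sig = fun N ω => L N ω + S N ω := funext₂ hmodel
  obtain rfl : ξ = fun N ω => leadingCols (hr N) (U N ω) := funext₂ hξ
  obtain rfl : ξhat = fun N ω => leadingCols (hr N) (Uhat N ω) := funext₂ hξhat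
  obtain rfl : ζ = fun N ω => leadingCols (hr N) (V N ω) := funext₂ hζ
  have hτ : ∀ N ω, 0 ≤ η N ω + ‖S N ω‖ := fun N ω => add_nonneg (hη N ω) (norm_nonneg _)
  have hδ : ∀ C : ℝ, 1 ≤ C → 0 < ((6 * R + 4) * C ^ 2)⁻¹ ∧
      (6 * R + 4) * C ^ 2 * ((6 * R + 4) * C ^ 2)⁻¹ = 1 := fun C hC => by
    have : 0 < (6 * R + 4) * C ^ 2 := by positivity
    exact ⟨inv_pos.2 this, mul_inv_cancel₀ this.ne'⟩
  have regime : ∀ ε : ℝ, 0 < ε → ∃ C₀ : ℝ, ∀ C, C₀ ≤ C → 1 ≤ C → ∀ᶠ N in atTop,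
      P {ω | ¬ PerturbationRegime (r N) (Sighat N ω) (L N ω) (S N ω) (η N ω) C
        ((6 * R + 4) * C ^ 2)⁻¹} ≤ ENNReal.ofReal ε := fun ε hε => by
    obtain ⟨C₀, h⟩ := exists_perturbationRegime hrank hη hgap hop hspike hε
    exact ⟨C₀, fun C hC hC1 => h C hC _ (hδ C hC1).1⟩
  refine ⟨⟨IsBigOP.of_event fun ε hε => ?_, IsBigOP.of_event fun ε hε => ?_⟩, fun hbdd _ => ?_⟩
  · obtain ⟨C₀, h⟩ := regime ε hε
    have hC1 := le_max_right C₀ 1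
    refine ⟨_, h (max C₀ 1) (le_max_left _ _) hC1, 2 * max C₀ 1, by positivity, ?_⟩
    intro N ω hG
    rw [abs_of_nonneg (norm_nonneg _), abs_of_nonneg (hτ N ω), ← hG.rank_eq]
    linarith [(hsvd_hat N ω).norm_hardThreshold_sub_le (hsvd N ω), hG.norm_sub_spike_le hC1]
  · obtain ⟨C₀, h⟩ := regime ε hε
    have hC1 := le_max_right C₀ 1
    refine ⟨_, h (max C₀ 1) (le_max_left _ _) hC1,
      (R + 1) * ((12 * R + 4) * max C₀ 1 ^ 2), by positivity, ?_⟩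
    intro N ω hG
    rw [abs_of_nonneg (norm_nonneg _),
      abs_of_nonneg (div_nonneg (hτ N ω) (maxGap_nonneg _ _))]
    exact hG.norm_leadingCols_sub_le hC1 (hR N) (hη N ω) (hδ _ hC1).2 (hsvd_hat N ω) (hsvd N ω)
      (hr N) (hsign N ω)
  -- One column bound serves both claims; `w'` is left free, to become a column norm or the norm of
  -- the whole matrix `Sᵀ ξ`.
  · have strong : ∀ ε : ℝ, 0 < ε → ∃ G : ℕ → Ω → Prop,
        (∀ᶠ N in atTop, P {ω | ¬ G N ω} ≤ ENNReal.ofReal ε) ∧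
        ∃ K : ℝ, 0 < K ∧ ∀ N ω, G N ω → ∀ (d : Fin (r N)) (w' : ℝ),
          ‖(leadingCols (hr N) (Uhat N ω)).col d - (leadingCols (hr N) (U N ω)).col d‖ ≤
            K * (((N₁ N : ℝ) / √(N : ℝ) + √(N₁ N : ℝ)) * (η N ω + ‖S N ω‖)
                * (maxGap (r N) (L N ω) ^ 2)⁻¹
              + (c N ω * ((N₁ N : ℝ) / √(N : ℝ)) + c N ω * √(N₁ N : ℝ)
                + max ‖S N ω *ᵥ (leadingCols (hr N) (V N ω)).col d‖ w')
                * (maxGap (r N) (L N ω))⁻¹) := by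
      intro ε hε
      have hε3 : 0 < ε / 3 := by positivity
      obtain ⟨C₀, h₀⟩ := regime _ hε3
      obtain ⟨C₁, h₁⟩ := hentry.eventually_not_le hε3
      obtain ⟨C₂, h₂⟩ := hbdd.eventually_not_le hε3
      obtain ⟨C, hC0, hC1, hC2, hC⟩ : ∃ C, C₀ ≤ C ∧ C₁ ≤ C ∧ C₂ ≤ C ∧ 1 ≤ C :=
        ⟨max (max C₀ C₁) (max C₂ 1), by simp, by simp, by simp, by simp⟩
      refine ⟨fun N ω => (PerturbationRegime (r N) (Sighat N ω) (L N ω) (S N ω) (η N ω) C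
          ((6 * R + 4) * C ^ 2)⁻¹ ∧ |entryNorm (Sighat N ω - (L N ω + S N ω))| ≤ C * |c N ω|) ∧
          |entryNorm (S N ω) + entryNorm (L N ω)| ≤ C * |1|, ?_, 2 * (16 * R + 5) * C ^ 4 + 2 * C ^ 2, by positivity, ?_⟩
      · filter_upwards [h₀ C hC0 hC, h₁ C hC1, h₂ C hC2] with N hN₀ hN₁ hN₂
        have hall := measure_not_and_le (by positivity) hε3.le
          (measure_not_and_le hε3.le hε3.le hN₀ hN₁) hN₂
        rwa [show ε / 3 + ε / 3 + ε / 3 = ε by ring] at hall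
      · rintro N ω ⟨⟨hG, hG₁⟩, hG₂⟩ d w'
        rw [abs_of_nonneg (entryNorm_nonneg _), abs_of_nonneg (hc N ω)] at hG₁
        rw [abs_one, mul_one] at hG₂
        exact hG.norm_col_sub_le hC (hR N) (hη N ω) (hδ C hC).2 (hsvd_hat N ω) (hsvd N ω) (hr N)
          (hsign N ω) (hc N ω) hG₁ ((le_abs_self _).trans hG₂) d (by positivity) w'
    have hrate : ∀ N ω (w : ℝ), 0 ≤ w →
        0 ≤ ((N₁ N : ℝ) / √(N : ℝ) + √(N₁ N : ℝ)) * (η N ω + ‖S N ω‖)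
            * (maxGap (r N) (L N ω) ^ 2)⁻¹
          + (c N ω * ((N₁ N : ℝ) / √(N : ℝ)) + c N ω * √(N₁ N : ℝ) + w)
            * (maxGap (r N) (L N ω))⁻¹ := fun N ω w hw => by
      have := hτ N ω
      have := hc N ω
      have := maxGap_nonneg (r N) (L N ω)
      positivity
    refine ⟨IsBigOP.of_event fun ε hε => ?_, IsBigOPUnif.of_event fun ε hε => ?_⟩
    · obtain ⟨G, hGP, K, hK, hG⟩ := strong ε hε
      refine ⟨G, hGP, K, hK, fun N ω hω => ?_⟩
      have h0 := hrate N ω _ ((entryNorm_nonneg (S N ω * leadingCols (hr N) (V N ω))).trans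
        (le_max_left _ (entryNorm ((S N ω)ᵀ * leadingCols (hr N) (U N ω)))))
      rw [abs_of_nonneg (entryNorm_nonneg _), abs_of_nonneg h0]
      refine entryNorm_le (mul_nonneg hK.le h0) fun i d => ?_
      refine (norm_le_pi_norm ((leadingCols (hr N) (Uhat N ω)).col d
        - (leadingCols (hr N) (U N ω)).col d) i).trans ((hG N ω hω d
          (entryNorm ((S N ω)ᵀ * leadingCols (hr N) (U N ω)))).trans ?_)
      -- It remains to replace the norm of the column `S ζ_d` by the entry norm of `S ζ`.
      have h1 := norm_col_le_entryNorm (S N ω * leadingCols (hr N) (V N ω)) d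
      have h2 : (S N ω * leadingCols (hr N) (V N ω)).col d =
        S N ω *ᵥ (leadingCols (hr N) (V N ω)).col d := rfl
      rw [h2] at h1
      have := maxGap_nonneg (r N) (L N ω)
      gcongr
    · obtain ⟨G, hGP, K, hK, hG⟩ := strong ε hε
      refine ⟨G, hGP, K, hK, fun N ω hω d => ?_⟩
      rw [abs_of_nonneg (norm_nonneg _), abs_of_nonneg (hrate N ω _
        ((norm_nonneg _).trans (le_max_left _ _)))]
      exact hG N ω hω d _
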